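/- **Criterion for efficient $\epsilon$-approximate $\delta$-stochastic universality.** *Setting.* States are density matrices on $N$ qubits, $N\in\mathbb N$, with one qubit per party. An LOCC protocol is a finite adaptive sequence of generalised one-qubit measurements with publicly announced outcomes, in which parties may also discard their qubits and classical records may be forgotten (branches merged); it maps $\rho$ to an ensemble $\{p_i,\rho_i\}$ of output branches. An *extendable strong entanglement monotone* is a real function $E$ on the states of any number of qubits that (P1) vanishes on fully separable states, (P2) satisfies $E(\sum_i p_i\rho_i)\le E(\rho)$ and (P4) $\sum_i p_iE(\rho_i)\le E(\rho)$ for every LOCC protocol $\rho\to\{p_i,\rho_i\}$, (P3) is convex, and (P5) satisfies $E(|\psi\rangle|0\rangle)=E(|\psi\rangle)$ for every pure $N$-qubit state, where $|\psi\rangle|0\rangle$ is regarded as an $(N+1)$-party state. $D$ is a distance (metric) on the $N$-qubit states for each $N$ that is convex and contractive under completely positive trace preserving maps (also between different numbers of qubits), and $E_\epsilon(\rho)=\inf\{E(\sigma): D(\sigma,\rho)\le\epsilon\}$. $|C_{d\times d}\rangle$ is the cluster state of the $d\times d$ square grid, on $N=d^2$ qubits. A family $\Sigma=\{\sigma_i\}_i$,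 where $\sigma_i$ is a state on $N_i$ qubits, is *efficient $\epsilon$-approximate $\delta$-stochastic universal* (with respect to $D$) if for every sequence $(|\phi_n\rangle)_n$ of $n$-qubit states that can be generated from product states by circuits of polynomially many one- and two-qubit gates there is a polynomial $q$ such that for every $n$ there are a member $\sigma_i\in\Sigma$ with $n\le N_i\le q(n)$ and an LOCC protocol on $\sigma_i$ with output branches $\{p_k,\rho_k\}_k$ for which $$\sum_{k:\,D(\rho_k,\;|\phi_n\rangle\langle\phi_n|\otimes|0\rangle\langle0|^{\otimes(N_i-n)})\le\epsilon}p_k\ \ge\ 1-\delta ,$$ and which is carried out in at most $q(n)$ elementary steps (classically controlled two-outcome one-qubit measurements, and elementary operations on bits of a classical memory) with at most $q(n)$ bits of classical memory. **Theorem.** Let $\epsilon\ge0$ and $0\le\delta<1$, let $D$ be such a distance and $E$ an extendable strong entanglement monotone. Let $f_\epsilon:\mathbb N\to\mathbb R$ be nondecreasing with $f_\epsilon(N)\to\infty$, and bounded for all large $N$ by some fixed finite iterate $\exp(\exp(\cdots\exp(N)))$ of the exponential function. Suppose that for all $d\ge1$ $$E_\epsilon(|C_{d\times d}\rangle)\ \ge\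 f_\epsilon(d^2).$$ Let $\Sigma=\{\sigma_i\}_i$ be a family of states, $\sigma_i$ on $N_i$ qubits. If $E(\sigma_i)=O(\log f_\epsilon(N_i))$ as $N_i\to\infty$, then $\Sigma$ is not an efficient $\epsilon$-approximate $\delta$-stochastic universal resource. -/

import Mathlib

open Filter Asymptotics
open scoped Matrix ComplexOrder

/-! ### Qubit states -/

/-- Computational basis labels of `n` qubits. -/
abbrev Bits (n : ℕ) : Type := Fin n → Fin 2

/-- Density matrices (mixed states) of `n` qubits, one qubit per party. -/
structure QState (n : ℕ) where
  mat : Matrix (Bits n) (Bits n) ℂ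
  posSemidef : mat.PosSemidef
  trace_eq_one : mat.trace = 1

/-- Normalised state vectors of `n` qubits. -/
structure PureState (n : ℕ) where
  amp : Bits n → ℂ
  normalized : ∑ x, ‖amp x‖ ^ 2 = 1

/-- The density matrix `|ψ⟩⟨ψ|`. -/
noncomputable def PureState.toState {n : ℕ} (ψ : PureState n) : QState n where
  mat := Matrix.vecMulVec ψ.amp (star ψ.amp)
  posSemidef := Matrix.posSemidef_vecMulVec_self_star ψ.amp
  trace_eq_one := by
    have h : ∀ x : Bits n, ψ.amp x * star (ψ.amp x) = ((‖ψ.amp x‖ ^ 2 : ℝ) : ℂ) := by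
      intro x
      rw [Complex.star_def, Complex.mul_conj, Complex.normSq_eq_norm_sq]
    simp only [Matrix.trace, Matrix.diag, Matrix.vecMulVec_apply, Pi.star_apply, h]
    rw [← Complex.ofReal_sum, ψ.normalized, Complex.ofReal_one]

/-- `|ψ⟩ ⊗ |0⟩^{⊗(m - n)}` as an `m`-qubit (that is, `m`-party) state. -/
noncomputable def PureState.pad {n m : ℕ} (h : n ≤ m) (ψ : PureState n) : PureState m where
  amp x := if ∀ j : Fin m, n ≤ j.val → x j = 0 then ψ.amp (fun i => x (Fin.castLE h i)) else 0
  normalized := by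
    rw [← ψ.normalized]
    symm
    refine Finset.sum_of_injOn
      (fun (y : Bits n) (j : Fin m) => if hj : j.val < n then y ⟨j.val, hj⟩ else 0) ?_ ?_ ?_ ?_
    · intro y _ z _ hyz
      funext i
      have := congrFun hyz (Fin.castLE h i)
      simpa using this
    · intro y _
      simp
    · intro x _ hx
      rw [if_neg]
      · simp
      · intro hx0
        refine hx ⟨fun i => x (Fin.castLE h i), by simp, ?_⟩
        funext j
        by_cases hj : j.val < n
        · simp only [hj, dif_pos]
          rfl
        · simp only [hj, dif_neg, not_false_eq_true]
          exact (hx0 j (not_lt.mp hj)).symm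
    · intro y _
      rw [if_pos]
      · simp
      · intro j hj
        simp [not_lt.mpr hj]

/-- Fully separable states: convex mixtures of products of one-qubit density matrices. -/
def QState.IsSeparable {n : ℕ} (ρ : QState n) : Prop :=
  ∃ (r : ℕ) (p : Fin r → ℝ) (τ : Fin r → Fin n → Matrix (Fin 2) (Fin 2) ℂ),
    (∀ k, 0 ≤ p k) ∧ ∑ k, p k = 1 ∧
    (∀ k j, (τ k j).PosSemidef ∧ (τ k j).trace = 1) ∧
    ∀ x y, ρ.mat x y = ∑ k, (p k : ℂ) * ∏ j, τ k j (x j) (y j)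

/-! ### Local operations and classical communication -/

/-- The one-qubit operator `A` acting on qubit `j` of `n`. -/
def oneQubitOp {n : ℕ} (j : Fin n) (A : Matrix (Fin 2) (Fin 2) ℂ) :
    Matrix (Bits n) (Bits n) ℂ :=
  fun x y => if ∀ i, i ≠ j → x i = y i then A (x j) (y j) else 0

/-- The two-qubit operator `A` acting on the qubits `i, j` of `n`. -/
def twoQubitOp {n : ℕ} (i j : Fin n) (A : Matrix (Fin 2 × Fin 2) (Fin 2 × Fin 2) ℂ) :
    Matrix (Bits n) (Bits n) ℂ :=
  fun x y => if ∀ k, k ≠ i → k ≠ j → x k = y k then A (x i, x j) (y i, y j) else 0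

/-- Partial trace over qubit `j`. -/
def traceOut {n : ℕ} (j : Fin (n + 1)) (ρ : Matrix (Bits (n + 1)) (Bits (n + 1)) ℂ) :
    Matrix (Bits n) (Bits n) ℂ :=
  fun x y => ∑ b : Fin 2, ρ (Fin.insertNth (α := fun _ => Fin 2) j b x)
    (Fin.insertNth (α := fun _ => Fin 2) j b y)

/-- Finite-round LOCC protocols from `n` to `m` qubits (one qubit per party), as decision trees.
A node is a generalised measurement of one qubit, with Kraus operators `K k`, whose outcome is
announced to all parties, or one party discarding its qubit. A leaf carries the label of the output
branch; leaves with the same label are merged (that part of the record is forgotten), so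
measurement outcomes with several Kraus operators, shared randomness and local ancillas
need no separate treatment. -/
inductive LOCC (L : Type) : ℕ → ℕ → Type
  | done {n : ℕ} (l : L) : LOCC L n n
  | measure {n m : ℕ} (j : Fin n) (r : ℕ) (K : Fin r → Matrix (Fin 2) (Fin 2) ℂ)
      (complete : ∑ k, (K k)ᴴ * K k = 1) (next : Fin r → LOCC L n m) : LOCC L n m
  | discard {n m : ℕ} (j : Fin (n + 1)) (next : LOCC L n m) : LOCC L (n + 1) m

open Classical in
/-- The unnormalised output (probability times state) of the branch labelled `l`. -/
noncomputable def LOCC.out {L : Type} : {n m : ℕ} → LOCC L n m →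
    Matrix (Bits n) (Bits n) ℂ → L → Matrix (Bits m) (Bits m) ℂ
  | _, _, .done l', ρ, l => if l = l' then ρ else 0
  | _, _, .measure j r K _ next, ρ, l =>
      ∑ k : Fin r, (next k).out (oneQubitOp j (K k) * ρ * (oneQubitOp j (K k))ᴴ) l
  | _, _, .discard j next, ρ, l => next.out (traceOut j ρ) l

/-- The protocol `P` maps `ρ` to the ensemble `{p l, τ l}`. -/
def LOCC.Yields {L : Type} {n m : ℕ} (P : LOCC L n m) (ρ : QState n) (p : L → ℝ)
    (τ : L → QState m) : Prop :=
  ∀ l, P.out ρ.mat l = (p l : ℂ) • (τ l).mat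

/-! ### Entanglement monotones -/

/-- Extendable strong entanglement monotones: a real function on the `n`-qubit states, for all `n`,
with the five properties below. -/
structure IsExtendableStrongMonotone (E : (n : ℕ) → QState n → ℝ) : Prop where
  /-- Vanishing on separable states. -/
  separable : ∀ (n : ℕ) (ρ : QState n), ρ.IsSeparable → E n ρ = 0
  /-- Monotonicity under LOCC. -/
  locc : ∀ (L : Type) [Fintype L] (n m : ℕ) (P : LOCC L n m) (ρ : QState n) (ρ' : QState m),
    ρ'.mat = ∑ l, P.out ρ.mat l → E m ρ' ≤ E n ρ
  /-- Convexity. -/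
  convex : ∀ (n : ℕ) (p : ℝ) (ρ ρ₁ ρ₂ : QState n), 0 ≤ p → p ≤ 1 →
    ρ.mat = (p : ℂ) • ρ₁.mat + ((1 - p : ℝ) : ℂ) • ρ₂.mat →
    E n ρ ≤ p * E n ρ₁ + (1 - p) * E n ρ₂
  /-- Monotonicity on average under LOCC. -/
  average : ∀ (L : Type) [Fintype L] (n m : ℕ) (P : LOCC L n m) (ρ : QState n) (p : L → ℝ)
    (τ : L → QState m), P.Yields ρ p τ → ∑ l, p l * E m (τ l) ≤ E n ρ
  /-- Trivial extendability. -/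
  extend : ∀ (n : ℕ) (ψ : PureState n),
    E (n + 1) (ψ.pad (Nat.le_succ n)).toState = E n ψ.toState

/-! ### Distances and epsilon-measures -/

/-- A distance on the states of `n` qubits, for all `n`, which is convex and contractive under
completely positive trace preserving maps (given by their Kraus operators). -/
structure IsConvexContractiveDistance (D : (n : ℕ) → QState n → QState n → ℝ) : Prop where
  eq_zero_iff : ∀ (n : ℕ) (ρ σ : QState n), D n ρ σ = 0 ↔ ρ = σ
  symm : ∀ (n : ℕ) (ρ σ : QState n), D n ρ σ = D n σ ρ
  triangle : ∀ (n : ℕ) (ρ σ τ : QState n), D n ρ τ ≤ D n ρ σ + D n σ τ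
  convex : ∀ (n : ℕ) (p : ℝ) (ρ ρ₁ ρ₂ τ : QState n), 0 ≤ p → p ≤ 1 →
    ρ.mat = (p : ℂ) • ρ₁.mat + ((1 - p : ℝ) : ℂ) • ρ₂.mat →
    D n ρ τ ≤ p * D n ρ₁ τ + (1 - p) * D n ρ₂ τ
  contractive : ∀ (n m r : ℕ) (K : Fin r → Matrix (Bits m) (Bits n) ℂ),
    ∑ k, (K k)ᴴ * K k = 1 → ∀ (ρ σ : QState n) (ρ' σ' : QState m),
    ρ'.mat = ∑ k, K k * ρ.mat * (K k)ᴴ → σ'.mat = ∑ k, K k * σ.mat * (K k)ᴴ →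
    D m ρ' σ' ≤ D n ρ σ

/-- The `ε`-measure `E_ε(ρ) = inf {E(σ) | D(σ, ρ) ≤ ε}`. -/
noncomputable def epsMeasure (E : (n : ℕ) → QState n → ℝ) (D : (n : ℕ) → QState n → QState n → ℝ)
    (ε : ℝ) {n : ℕ} (ρ : QState n) : ℝ :=
  sInf (E n '' {σ : QState n | D n σ ρ ≤ ε})

/-! ### Cluster states -/

/-- `b` is the right or the lower neighbour of `a` in the `d × d` square grid. -/
def GridStep {d : ℕ} (a b : Fin d × Fin d) : Prop :=
  (a.1 = b.1 ∧ a.2.val + 1 = b.2.val) ∨ (a.1.val + 1 = b.1.val ∧ a.2 = b.2)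

instance {d : ℕ} (a b : Fin d × Fin d) : Decidable (GridStep a b) := by
  unfold GridStep
  infer_instance

/-- The cluster state of the `d × d` grid: a controlled phase gate on each edge of the grid, applied
to `|+⟩^{⊗ d * d}`. -/
noncomputable def clusterState (d : ℕ) : PureState (d * d) where
  amp x := ((Real.sqrt (2 ^ (d * d)))⁻¹ : ℝ) *
    ∏ a : Fin d × Fin d, ∏ b : Fin d × Fin d,
      if GridStep a b ∧ x (finProdFinEquiv a) = 1 ∧ x (finProdFinEquiv b) = 1 then -1 else 1
  normalized := by
    have h : ∀ x : Bits (d * d), ‖(((Real.sqrt (2 ^ (d * d)))⁻¹ : ℝ) : ℂ) *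
        ∏ a : Fin d × Fin d, ∏ b : Fin d × Fin d,
          (if GridStep a b ∧ x (finProdFinEquiv a) = 1 ∧ x (finProdFinEquiv b) = 1
            then -1 else 1 : ℂ)‖ ^ 2 = ((2 : ℝ) ^ (d * d))⁻¹ := by
      intro x
      have h1 : ∀ a b : Fin d × Fin d,
          ‖(if GridStep a b ∧ x (finProdFinEquiv a) = 1 ∧ x (finProdFinEquiv b) = 1
            then -1 else 1 : ℂ)‖ = 1 := by
        intro a b
        split_ifs <;> simp
      rw [norm_mul, norm_prod]
      simp only [norm_prod, h1, Finset.prod_const_one, mul_one, Complex.norm_real, norm_inv,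
        Real.norm_eq_abs, inv_pow, sq_abs]
      rw [Real.sq_sqrt (by positivity)]
    simp only [h, Finset.sum_const, Finset.card_univ, Fintype.card_pi, Fintype.card_fin,
      Finset.prod_const, nsmul_eq_mul, Nat.cast_pow, Nat.cast_ofNat]
    exact mul_inv_cancel₀ (by positivity)

/-! ### Quantum circuits -/

/-- Elementary gates on `n` qubits: one-qubit unitaries and two-qubit unitaries. -/
inductive Gate (n : ℕ) : Type
  | one (j : Fin n) (U : Matrix.unitaryGroup (Fin 2) ℂ) : Gate n
  | two (i j : Fin n) (distinct : i ≠ j) (U : Matrix.unitaryGroup (Fin 2 × Fin 2) ℂ) : Gate n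

/-- The unitary matrix of a gate. -/
def Gate.op {n : ℕ} : Gate n → Matrix (Bits n) (Bits n) ℂ
  | .one j U => oneQubitOp j U.val
  | .two i j _ U => twoQubitOp i j U.val

/-- `ψ` is produced from a product state by a quantum circuit with at most `s` elementary gates. -/
def PureState.HasCircuit {n : ℕ} (ψ : PureState n) (s : ℕ) : Prop :=
  ∃ (v : Fin n → Fin 2 → ℂ) (c : List (Gate n)), (∀ j, ∑ b, ‖v j b‖ ^ 2 = 1) ∧ c.length ≤ s ∧
    ψ.amp = c.foldl (fun χ g => g.op *ᵥ χ) (fun x => ∏ j, v j (x j))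

/-- A family of states, one for each number of qubits, with circuits of polynomial size. -/
def HasPolyCircuits (φ : (n : ℕ) → PureState n) : Prop :=
  ∃ q : Polynomial ℕ, ∀ n, (φ n).HasCircuit (q.eval n)

/-! ### Time-bounded LOCC protocols -/

/-- Elementary steps of an LOCC protocol on `n` qubits steered by a classical computer with `w` bits
of memory. -/
inductive Step (n w : ℕ) : Type
  /-- Classical processing: replace bit `c` by `g` of the bits `a` and `b`. -/
  | compute (g : Fin 2 → Fin 2 → Fin 2) (a b c : Fin w) : Step n w
  /-- A two-outcome generalised measurement of qubit `j`, one of two as decided by bit `a`; the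
  outcome is stored in bit `c`. -/
  | measure (j : Fin n) (K : Fin 2 → Fin 2 → Matrix (Fin 2) (Fin 2) ℂ)
      (complete : ∀ s, ∑ k, (K s k)ᴴ * K s k = 1) (a c : Fin w) : Step n w

/-- The LOCC protocol that a list of steps carries out from a given content of the classical memory.
The output branches are labelled by the final content of the memory. -/
def runSteps {n w : ℕ} : List (Step n w) → (Fin w → Fin 2) → LOCC (Fin w → Fin 2) n n
  | [], s => .done s
  | .compute g a b c :: rest, s => runSteps rest (Function.update s c (g (s a) (s b)))
  | .measure j K complete a c :: rest, s =>
      .measure j 2 (K (s a)) (complete (s a)) (fun k => runSteps rest (Function.update s c k))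

/-! ### Efficient universality -/

/-- From `ρ`, the protocol `P` produces output branches such that those within distance `ε` of the
target have total probability at least `1 - δ`. -/
def LOCC.Produces {L : Type} [Fintype L] {n m : ℕ} (P : LOCC L n m)
    (D : (n : ℕ) → QState n → QState n → ℝ) (ε δ : ℝ) (ρ : QState n) (target : QState m) : Prop :=
  ∃ (p : L → ℝ) (τ : L → QState m), P.Yields ρ p τ ∧
    1 - δ ≤ ∑ l, if D m (τ l) target ≤ ε then p l else 0

/-- Efficient `ε`-approximate `δ`-stochastic universality of the family of `N i`-qubit states `σ i`:
every family of states `φ n` with polynomial-size quantum circuits is obtained, padded with qubits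
in state `|0⟩`, from members of the family with polynomially many qubits, by LOCC protocols with
polynomial time (the total number of quantum and classical steps) and polynomial classical
memory. -/
def IsEfficientUniversal (D : (n : ℕ) → QState n → QState n → ℝ) (ε δ : ℝ) {ι : Type*} (N : ι → ℕ)
    (σ : (i : ι) → QState (N i)) : Prop :=
  ∀ φ : (n : ℕ) → PureState n, HasPolyCircuits φ →
    ∃ q : Polynomial ℕ, ∀ n, ∃ (i : ι) (h : n ≤ N i), N i ≤ q.eval n ∧
      ∃ (w : ℕ) (c : List (Step (N i) w)), w ≤ q.eval n ∧ c.length ≤ q.eval n ∧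
        (runSteps c (fun _ => 0)).Produces D ε δ (σ i) ((φ n).pad h).toState

/-! Suppose the family were universal. Cluster states have polynomial-size circuits, so each can be
produced from some `σ i` of size polynomial in n = d². Discarding the padding qubits of a branch,
and of the target, increases neither their distance nor E, so every branch near the target has E at
least E_ε of the cluster state (`epsMeasure_le_of_dist_pad_le`). Averaging over branches gives (1 -
δ) f(n) ≤ E(σ i) (`LOCC.Produces.mul_epsMeasure_le`). With the assumed scaling, f(n) ≤ C log f(n^k)
on all large squares n.

Along squares with n_{m+1} = n_m^k this says f(n_{m+1}) ≥ exp(f(n_m) / C), so f(n_m) grows like a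
tower whose height increases with m. But n_m is only doubly exponential in m, so no tower of fixed
height applied to n can bound f (`not_le_log_of_growth`). -/

/-! ### Partial trace -/

/-- Sums over `n + 1` bits split off bit `j`. -/
theorem sum_insertNth {n : ℕ} {M : Type*} [AddCommMonoid M] (j : Fin (n + 1))
    (F : Bits (n + 1) → M) :
    ∑ x : Bits n, ∑ b : Fin 2, F (Fin.insertNth (α := fun _ => Fin 2) j b x) = ∑ y, F y := by
  rw [Finset.sum_comm, ← Fintype.sum_prod_type' (f := fun b x => F (Fin.insertNth j b x))]
  exact (Fin.insertNthEquiv (fun _ => Fin 2) j).sum_comp F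

theorem traceOut_eq_sum_submatrix {n : ℕ} (j : Fin (n + 1))
    (ρ : Matrix (Bits (n + 1)) (Bits (n + 1)) ℂ) :
    traceOut j ρ = ∑ b : Fin 2, ρ.submatrix (Fin.insertNth (α := fun _ => Fin 2) j b)
      (Fin.insertNth (α := fun _ => Fin 2) j b) := by
  ext x y
  simp [traceOut, Matrix.sum_apply]

theorem posSemidef_traceOut {n : ℕ} (j : Fin (n + 1))
    {ρ : Matrix (Bits (n + 1)) (Bits (n + 1)) ℂ} (h : ρ.PosSemidef) :
    (traceOut j ρ).PosSemidef := by
  rw [traceOut_eq_sum_submatrix]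
  exact Matrix.posSemidef_sum _ fun b _ => h.submatrix _

theorem trace_traceOut {n : ℕ} (j : Fin (n + 1)) (ρ : Matrix (Bits (n + 1)) (Bits (n + 1)) ℂ) :
    (traceOut j ρ).trace = ρ.trace :=
  sum_insertNth j fun y => ρ y y

/-- The state left after qubit `j` is discarded. -/
noncomputable def QState.traceOut {n : ℕ} (j : Fin (n + 1)) (ρ : QState (n + 1)) : QState n where
  mat := _root_.traceOut j ρ.mat
  posSemidef := posSemidef_traceOut j ρ.posSemidef
  trace_eq_one := by rw [trace_traceOut, ρ.trace_eq_one]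

/-- The Kraus operator `⟨b|` on qubit `j`. -/
def traceOutKraus {n : ℕ} (j : Fin (n + 1)) (b : Fin 2) : Matrix (Bits n) (Bits (n + 1)) ℂ :=
  (1 : Matrix (Bits (n + 1)) (Bits (n + 1)) ℂ).submatrix
    (Fin.insertNth (α := fun _ => Fin 2) j b) id

theorem sum_traceOutKraus_conjTranspose_mul {n : ℕ} (j : Fin (n + 1)) :
    ∑ b, (traceOutKraus j b)ᴴ * traceOutKraus j b = 1 := by
  ext y z
  simp only [Matrix.sum_apply, Matrix.mul_apply, Matrix.conjTranspose_apply, traceOutKraus,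
    Matrix.submatrix_apply]
  rw [Finset.sum_comm]
  refine (sum_insertNth j fun u => star ((1 : Matrix (Bits (n + 1)) _ ℂ) u y) *
    (1 : Matrix (Bits (n + 1)) _ ℂ) u z).trans ?_
  simp [Matrix.one_apply, eq_comm]

theorem traceOut_eq_sum_kraus {n : ℕ} (j : Fin (n + 1))
    (ρ : Matrix (Bits (n + 1)) (Bits (n + 1)) ℂ) :
    traceOut j ρ = ∑ b, traceOutKraus j b * ρ * (traceOutKraus j b)ᴴ := by
  ext x y
  simp [traceOut, Matrix.sum_apply, Matrix.mul_apply, traceOutKraus, Matrix.one_apply]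

theorem IsConvexContractiveDistance.traceOut_le {D : (n : ℕ) → QState n → QState n → ℝ}
    (hD : IsConvexContractiveDistance D) {n : ℕ} (j : Fin (n + 1)) (ρ σ : QState (n + 1)) :
    D n (ρ.traceOut j) (σ.traceOut j) ≤ D (n + 1) ρ σ :=
  hD.contractive (n + 1) n 2 (traceOutKraus j) (sum_traceOutKraus_conjTranspose_mul j) ρ σ _ _
    (traceOut_eq_sum_kraus j _) (traceOut_eq_sum_kraus j _)

theorem IsExtendableStrongMonotone.traceOut_le {E : (n : ℕ) → QState n → ℝ}
    (hE : IsExtendableStrongMonotone E) {n : ℕ} (j : Fin (n + 1)) (ρ : QState (n + 1)) :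
    E n (ρ.traceOut j) ≤ E (n + 1) ρ :=
  hE.locc Unit (n + 1) n (.discard j (.done ())) ρ _ (by simp [LOCC.out, QState.traceOut])

/-- On zero qubits the only density matrix is the 1 × 1 identity, an empty product. -/
theorem QState.isSeparable_zero (ρ : QState 0) : ρ.IsSeparable := by
  refine ⟨1, fun _ => 1, fun _ _ => 0, by simp, by simp, fun _ j => j.elim0, fun x y => ?_⟩
  have h : ρ.mat x x = 1 := by
    rw [← ρ.trace_eq_one, Matrix.trace, Fintype.sum_subsingleton _ x, Matrix.diag_apply]
  rw [Subsingleton.elim y x, h]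
  simp

/-- Discarding the qubits one by one never raises E and ends in a separable state, where E is 0. -/
theorem IsExtendableStrongMonotone.nonneg {E : (n : ℕ) → QState n → ℝ}
    (hE : IsExtendableStrongMonotone E) : ∀ {n : ℕ} (ρ : QState n), 0 ≤ E n ρ
  | 0, ρ => (hE.separable 0 ρ ρ.isSeparable_zero).ge
  | _ + 1, ρ => (hE.nonneg (ρ.traceOut 0)).trans (hE.traceOut_le 0 ρ)

/-! ### Padding qubits -/

theorem PureState.pad_self {n : ℕ} (ψ : PureState n) : ψ.pad le_rfl = ψ := by
  cases ψ
  simp only [PureState.pad, PureState.mk.injEq]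
  funext x
  rw [if_pos fun j hj => absurd j.isLt (not_lt.mpr hj)]
  rfl

theorem QState.ext_mat {n : ℕ} {ρ σ : QState n} (h : ρ.mat = σ.mat) : ρ = σ := by
  cases ρ
  cases σ
  simpa using h

theorem PureState.pad_succ_amp {n m : ℕ} (h : n ≤ m) (ψ : PureState n) (b : Fin 2) (x : Bits m) :
    (ψ.pad (h.trans (Nat.le_succ m))).amp
      (Fin.snoc (α := fun _ => Fin 2) x b) =
      if b = 0 then (ψ.pad h).amp x else 0 := by
  have hx : ∀ i : Fin m, Fin.snoc (α := fun _ => Fin 2) x b i.castSucc = x i := by simp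
  have hc : (fun i => Fin.snoc (α := fun _ => Fin 2) x b
      (Fin.castLE (h.trans (Nat.le_succ m)) i)) = fun i => x (Fin.castLE h i) :=
    funext fun i => hx (Fin.castLE h i)
  simp only [PureState.pad, Fin.forall_fin_succ', Fin.snoc_castSucc,
    Fin.snoc_last, Fin.val_castSucc, Fin.val_last, h, forall_const, hc]
  split_ifs <;> simp_all

theorem PureState.traceOut_pad_succ {n m : ℕ} (h : n ≤ m) (ψ : PureState n) :
    (ψ.pad (h.trans (Nat.le_succ m))).toState.traceOut (Fin.last m) = (ψ.pad h).toState := by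
  refine QState.ext_mat ?_
  ext x y
  simp [QState.traceOut, traceOut, PureState.toState, Matrix.vecMulVec_apply,
    PureState.pad_succ_amp h]

/-- The `ε`-measure of `ψ` bounds the entanglement of all states close to `ψ` with padding. -/
theorem epsMeasure_le_of_dist_pad_le {E : (n : ℕ) → QState n → ℝ}
    (hE : IsExtendableStrongMonotone E) {D : (n : ℕ) → QState n → QState n → ℝ}
    (hD : IsConvexContractiveDistance D) {ε : ℝ} {n : ℕ} (ψ : PureState n) {m : ℕ} (h : n ≤ m)
    (σ : QState m) (hσ : D m σ (ψ.pad h).toState ≤ ε) : epsMeasure E D ε ψ.toState ≤ E m σ := by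
  induction m, h using Nat.le_induction with
  | base =>
    rw [PureState.pad_self] at hσ
    -- Nonnegativity of E supplies the lower bound that the real infimum needs.
    refine csInf_le ⟨0, ?_⟩ ⟨σ, hσ, rfl⟩
    rintro _ ⟨τ, -, rfl⟩
    exact hE.nonneg τ
  | succ m h ih =>
    refine (ih (σ.traceOut (Fin.last m)) ?_).trans (hE.traceOut_le _ σ)
    rw [← PureState.traceOut_pad_succ h]
    exact (hD.traceOut_le _ _ _).trans hσ

/-! ### Output branches -/

theorem LOCC.posSemidef_out {L : Type} {n m : ℕ} (P : LOCC L n m) (l : L) :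
    ∀ {ρ : Matrix (Bits n) (Bits n) ℂ}, ρ.PosSemidef → (P.out ρ l).PosSemidef := by
  induction P with
  | done l' =>
    intro ρ h
    rw [LOCC.out]
    split_ifs
    exacts [h, Matrix.PosSemidef.zero]
  | measure j r K _ next ih =>
    intro ρ h
    rw [LOCC.out]
    exact Matrix.posSemidef_sum _ fun k _ => ih k (h.mul_mul_conjTranspose_same _)
  | discard j next ih =>
    intro ρ h
    rw [LOCC.out]
    exact ih (posSemidef_traceOut j h)

/-- The weight of a branch is the trace of its positive semidefinite unnormalised output. -/
theorem LOCC.Yields.nonneg {L : Type} {n m : ℕ} {P : LOCC L n m} {ρ : QState n} {p : L → ℝ}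
    {τ : L → QState m} (h : P.Yields ρ p τ) (l : L) : 0 ≤ p l := by
  have h1 := (P.posSemidef_out l ρ.posSemidef).trace_nonneg
  rw [h l, Matrix.trace_smul, (τ l).trace_eq_one, smul_eq_mul, mul_one] at h1
  exact_mod_cast h1

/-- Producing `ψ` costs entanglement. -/
theorem LOCC.Produces.mul_epsMeasure_le {E : (n : ℕ) → QState n → ℝ}
    (hE : IsExtendableStrongMonotone E) {D : (n : ℕ) → QState n → QState n → ℝ}
    (hD : IsConvexContractiveDistance D) {ε δ : ℝ} {L : Type} [Fintype L] {n k m : ℕ}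
    {P : LOCC L k m} {ρ : QState k} {ψ : PureState n} {h : n ≤ m}
    (hP : P.Produces D ε δ ρ (ψ.pad h).toState) {a : ℝ} (ha : 0 ≤ a)
    (haψ : a ≤ epsMeasure E D ε ψ.toState) : (1 - δ) * a ≤ E k ρ := by
  obtain ⟨p, τ, hy, hsum⟩ := hP
  calc (1 - δ) * a ≤ (∑ l, if D m (τ l) (ψ.pad h).toState ≤ ε then p l else 0) * a :=
        mul_le_mul_of_nonneg_right hsum ha
    _ = ∑ l, (if D m (τ l) (ψ.pad h).toState ≤ ε then p l else 0) * a := Finset.sum_mul ..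
    -- Branches near the target have E at least a; for the others E ≥ 0 suffices.
    _ ≤ ∑ l, p l * E m (τ l) := by
        refine Finset.sum_le_sum fun l _ => ?_
        split_ifs with hl
        · exact mul_le_mul_of_nonneg_left
            (haψ.trans (epsMeasure_le_of_dist_pad_le hE hD ψ h _ hl)) (hy.nonneg l)
        · rw [zero_mul]
          exact mul_nonneg (hy.nonneg l) (hE.nonneg _)
    _ ≤ E k ρ := hE.average L k m P ρ p τ hy

/-! ### Circuits for cluster states -/

/-- The controlled phase gate. -/
noncomputable def controlledPhase : Matrix.unitaryGroup (Fin 2 × Fin 2) ℂ :=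
  ⟨Matrix.diagonal fun z => if z.1 = 1 ∧ z.2 = 1 then -1 else 1, by
    rw [Matrix.mem_unitaryGroup_iff, Matrix.star_eq_conjTranspose, Matrix.diagonal_conjTranspose,
      Matrix.diagonal_mul_diagonal, ← Matrix.diagonal_one]
    congr 1
    funext z
    by_cases h : z.1 = 1 ∧ z.2 = 1 <;> simp [h]⟩

theorem op_controlledPhase_mulVec {n : ℕ} {i j : Fin n} (h : i ≠ j) (χ : Bits n → ℂ) :
    (Gate.two i j h controlledPhase).op *ᵥ χ =
      fun x => (if x i = 1 ∧ x j = 1 then -1 else 1) * χ x := by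
  funext x
  rw [Matrix.mulVec, dotProduct, Finset.sum_eq_single x]
  · simp [Gate.op, twoQubitOp, controlledPhase]
  · intro y _ hy
    refine mul_eq_zero_of_left ?_ _
    simp only [Gate.op, twoQubitOp, controlledPhase]
    split_ifs with hk
    · refine Matrix.diagonal_apply_ne _ fun hxy => hy (funext fun k => ?_)
      by_cases hi : k = i
      · subst hi; exact (congrArg Prod.fst hxy).symm
      · by_cases hj : k = j
        · subst hj; exact (congrArg Prod.snd hxy).symm
        · exact (hk k hi hj).symm
    · rfl
  · simp

theorem GridStep.ne {d : ℕ} {a b : Fin d × Fin d} (h : GridStep a b) : a ≠ b := by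
  rintro rfl
  rcases h with ⟨-, h⟩ | ⟨h, -⟩ <;> omega

/-- The controlled phase gates on those of the given pairs of vertices that are edges. -/
noncomputable def clusterGates {d : ℕ} (l : List ((Fin d × Fin d) × Fin d × Fin d)) :
    List (Gate (d * d)) :=
  l.filterMap fun e => if h : GridStep e.1 e.2 then
    some (.two (finProdFinEquiv e.1) (finProdFinEquiv e.2)
      (finProdFinEquiv.injective.ne h.ne) controlledPhase) else none

/-- The gates are diagonal, so they only multiply amplitudes by signs. Pairs that are not edges give
no gate and a factor 1, which matches the product over all pairs in `clusterState`. -/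
theorem foldl_clusterGates {d : ℕ} (l : List ((Fin d × Fin d) × Fin d × Fin d))
    (χ : Bits (d * d) → ℂ) :
    (clusterGates l).foldl (fun χ g => g.op *ᵥ χ) χ = fun x => χ x * (l.map fun e =>
      if GridStep e.1 e.2 ∧ x (finProdFinEquiv e.1) = 1 ∧ x (finProdFinEquiv e.2) = 1
        then (-1 : ℂ) else 1).prod := by
  induction l generalizing χ with
  | nil => simp [clusterGates]
  | cons e l ih =>
    by_cases h : GridStep e.1 e.2
    · have : clusterGates (e :: l) = .two (finProdFinEquiv e.1) (finProdFinEquiv e.2)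
        (finProdFinEquiv.injective.ne h.ne) controlledPhase :: clusterGates l := by
        simp [clusterGates, h]
      rw [this, List.foldl_cons, ih, op_controlledPhase_mulVec]
      funext x
      simp only [List.map_cons, List.prod_cons, h, true_and]
      ring
    · have : clusterGates (e :: l) = clusterGates l := by simp [clusterGates, h]
      rw [this, ih]
      simp [h]

theorem hasCircuit_clusterState (d : ℕ) : (clusterState d).HasCircuit ((d * d) ^ 2) := by
  -- The input is |+⟩ on every qubit; the size bound counts all ordered pairs of vertices.
  refine ⟨fun _ _ => ((Real.sqrt 2)⁻¹ : ℝ), clusterGates Finset.univ.toList, ?_, ?_, ?_⟩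
  · intro j
    simp
  · refine (List.length_filterMap_le _ _).trans ?_
    simp [sq]
  · rw [foldl_clusterGates]
    funext x
    simp only [clusterState, Finset.prod_const, Finset.card_univ, Fintype.card_fin,
      Finset.prod_map_toList, Fintype.prod_prod_type]
    congr 1
    rw [← Complex.ofReal_pow, inv_pow, Real.sqrt_eq_rpow, Real.sqrt_eq_rpow,
      ← Real.rpow_natCast, ← Real.rpow_natCast, ← Real.rpow_mul, ← Real.rpow_mul, mul_comm] <;>
      norm_num

/-- The product state `|0 ⋯ 0⟩`. -/
def zeroState (n : ℕ) : PureState n where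
  amp x := ∏ j, if x j = 0 then 1 else 0
  normalized := by
    rw [Finset.sum_eq_single (fun _ => 0)]
    · simp
    · intro x _ hx
      obtain ⟨j, hj⟩ := Function.ne_iff.mp hx
      rw [Finset.prod_eq_zero (Finset.mem_univ j) (if_neg hj)]
      simp
    · simp

theorem hasCircuit_zeroState (n s : ℕ) : (zeroState n).HasCircuit s :=
  ⟨fun _ b => if b = 0 then 1 else 0, [], by simp, by simp, rfl⟩

/-- Some family with polynomial-size circuits contains all cluster states. -/
theorem exists_hasPolyCircuits_clusterState :
    ∃ φ : (n : ℕ) → PureState n, HasPolyCircuits φ ∧ ∀ d, φ (d * d) = clusterState d := by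
  -- A sequence needs a state for every n, so non-squares are filled with |0 ⋯ 0⟩.
  have key : ∀ n, ∃ ψ : PureState n, ψ.HasCircuit (n ^ 2) ∧
      ∀ d, (h : n = d * d) → h ▸ ψ = clusterState d := by
    intro n
    by_cases hn : ∃ d, n = d * d
    · obtain ⟨d, rfl⟩ := hn
      refine ⟨clusterState d, hasCircuit_clusterState d, fun e h => ?_⟩
      obtain rfl : d = e := Nat.mul_self_inj.mp h
      rfl
    · exact ⟨zeroState n, hasCircuit_zeroState n _, fun d h => absurd ⟨d, h⟩ hn⟩
  choose φ hφ hφ' using key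
  exact ⟨φ, ⟨Polynomial.X ^ 2, by simpa using hφ⟩, fun d => hφ' _ d rfl⟩

/-! ### Growth -/

/-- For n ≥ 2 a coefficient a is at most n ^ a, and one more factor n absorbs a sum of two powers.
-/
theorem Polynomial.exists_eval_le_pow (q : Polynomial ℕ) :
    ∃ k, ∀ n, 2 ≤ n → q.eval n ≤ n ^ k := by
  induction q using Polynomial.induction_on' with
  | add p q hp hq =>
    obtain ⟨a, ha⟩ := hp
    obtain ⟨b, hb⟩ := hq
    refine ⟨a + b + 1, fun n hn => ?_⟩
    have h1 : n ^ a ≤ n ^ (a + b) := Nat.pow_le_pow_right (by omega) (by omega)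
    have h2 : n ^ b ≤ n ^ (a + b) := Nat.pow_le_pow_right (by omega) (by omega)
    rw [Polynomial.eval_add, pow_succ]
    nlinarith [ha n hn, hb n hn]
  | monomial j a =>
    refine ⟨a + j, fun n hn => ?_⟩
    rw [Polynomial.eval_monomial, pow_add]
    exact Nat.mul_le_mul_right _ ((Nat.lt_two_pow_self).le.trans (Nat.pow_le_pow_left hn a))

theorem mul_iterate_exp_le {C x : ℝ} (hC : 1 ≤ C) (hx : 1 ≤ x) (r : ℕ) :
    1 ≤ Real.exp^[r] x ∧ C * Real.exp^[r] x ≤ Real.exp^[r] (C * x) := by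
  induction r with
  | zero => simpa using hx
  | succ r ih =>
    obtain ⟨h1, h2⟩ := ih
    simp only [Function.iterate_succ_apply']
    refine ⟨Real.one_le_exp (by linarith), ?_⟩
    calc C * Real.exp (Real.exp^[r] x) ≤ Real.exp (C - 1) * Real.exp (Real.exp^[r] x) := by
          gcongr
          linarith [Real.add_one_le_exp (C - 1)]
      _ = Real.exp (C - 1 + Real.exp^[r] x) := (Real.exp_add ..).symm
      -- With y = `Real.exp^[r] x`, (C - 1)(y - 1) ≥ 0 gives C - 1 + y ≤ C y; this is why y ≥ 1 is
      -- carried through the induction.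
      _ ≤ Real.exp (Real.exp^[r] (C * x)) := by
          gcongr
          nlinarith

/-- A sequence with `a m ≤ C * log (a (m + 1))` outgrows all `exp^[r] (B * K ^ m)`. -/
theorem not_eventually_le_iterate_exp {a : ℕ → ℝ} (ha : Tendsto a atTop atTop) {C K : ℝ}
    (hC : 1 ≤ C) (hK : 1 ≤ K) (hstep : ∀ᶠ m in atTop, a m ≤ C * Real.log (a (m + 1))) (r : ℕ) :
    ∀ B : ℝ, 1 ≤ B → ¬ ∀ᶠ m in atTop, a m ≤ Real.exp^[r] (B * K ^ m) := by
  have hpos := ha.eventually_ge_atTop 1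
  induction r with
  | zero =>
    intro B hB hle
    -- Since `a (m + 1)` is at least exp(`a m` / C), it eventually exceeds `(K + 1) * a m`, a
    -- geometric rate that beats B K^m.
    have hexp : ∀ᶠ x : ℝ in atTop, (K + 1) * x ≤ Real.exp (x / C) := by
      have h1 : Tendsto (fun x : ℝ => Real.exp (x / C) / (x / C) ^ 1) atTop atTop :=
        (Real.tendsto_exp_div_pow_atTop 1).comp (tendsto_id.atTop_div_const (by linarith))
      filter_upwards [h1.eventually_ge_atTop ((K + 1) * C), eventually_gt_atTop 0] with x hx hx0
      have hxC : 0 < x / C := by positivity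
      rw [pow_one, le_div_iff₀ hxC, mul_assoc, mul_div_cancel₀ _ (by linarith : C ≠ 0)] at hx
      exact hx
    obtain ⟨M, hM⟩ := eventually_atTop.mp
      ((((ha.eventually hexp).and hstep).and hpos).and
        (((tendsto_add_atTop_nat 1).eventually hpos).and hle))
    have hgrow : ∀ j, (K + 1) ^ j ≤ a (M + j) := by
      intro j
      induction j with
      | zero => simpa using (hM M le_rfl).1.2
      | succ j ih =>
        obtain ⟨⟨⟨h1, h2⟩, -⟩, h3, -⟩ := hM (M + j) (by omega)
        have h4 : Real.exp (a (M + j) / C) ≤ a (M + j + 1) := by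
          rw [← Real.le_log_iff_exp_le (by linarith), div_le_iff₀' (by linarith)]
          exact h2
        calc (K + 1) ^ (j + 1) = (K + 1) * (K + 1) ^ j := pow_succ' ..
          _ ≤ (K + 1) * a (M + j) := by gcongr
          _ ≤ a (M + (j + 1)) := h1.trans h4
    obtain ⟨j, hj⟩ := pow_unbounded_of_one_lt (B * K ^ M)
      (show 1 < (K + 1) / K by rw [lt_div_iff₀ (by linarith)]; linarith)
    have h5 := (hgrow j).trans (hM (M + j) (by omega)).2.2
    rw [div_pow, lt_div_iff₀ (by positivity)] at hj
    rw [Function.iterate_zero, id, pow_add, ← mul_assoc] at h5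
    linarith
  | succ r ih =>
    intro B hB hle
    -- The logarithm strips one exponential from the bound at m + 1. The shift of index costs the
    -- factor K, and C moves inside the remaining tower.
    refine ih (C * (B * K)) (one_le_mul_of_one_le_of_one_le hC
      (one_le_mul_of_one_le_of_one_le hB hK)) ?_
    filter_upwards [hstep, (tendsto_add_atTop_nat 1).eventually hpos,
      (tendsto_add_atTop_nat 1).eventually hle] with m h1 h2 h3
    rw [Function.iterate_succ_apply', ← Real.log_le_iff_le_exp (by linarith)] at h3
    calc a m ≤ C * Real.log (a (m + 1)) := h1
      _ ≤ C * Real.exp^[r] (B * K ^ (m + 1)) := by gcongr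
      _ ≤ Real.exp^[r] (C * (B * K ^ (m + 1))) :=
          (mul_iterate_exp_le hC (one_le_mul_of_one_le_of_one_le hB (one_le_pow₀ hK)) r).2
      _ = Real.exp^[r] (C * (B * K) * K ^ m) := by
          congr 1
          ring

/-- A function of bounded exponential tower growth cannot satisfy `f n ≤ C * log (f (n ^ k))` on
all large squares `n`. -/
theorem not_le_log_of_growth {f : ℕ → ℝ} (hf_top : Tendsto f atTop atTop)
    (hf_growth : ∃ r : ℕ, ∀ᶠ n : ℕ in atTop, f n ≤ Real.exp^[r] (n : ℝ)) {C : ℝ} (hC : 1 ≤ C)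
    {k : ℕ} (hk : 2 ≤ k) {M : ℕ}
    (h : ∀ d, M ≤ d → f (d * d) ≤ C * Real.log (f (d ^ k * d ^ k))) : False := by
  obtain ⟨r, hr⟩ := hf_growth
  obtain ⟨b, hb2, hbM⟩ : ∃ b : ℕ, 2 ≤ b ∧ M ≤ b := ⟨max 2 M, le_max_left .., le_max_right ..⟩
  set s : ℕ → ℕ := fun m => b ^ k ^ m with hs
  have hbs : ∀ m, b ≤ s m := fun m => Nat.le_self_pow (by positivity) b
  have hms : ∀ m, m ≤ s m * s m := fun m =>
    calc m ≤ k ^ m := (Nat.lt_pow_self (by omega)).le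
      _ ≤ s m := (Nat.lt_pow_self (by omega)).le
      _ ≤ s m * s m := Nat.le_mul_self _
  have htop : Tendsto (fun m => s m * s m) atTop atTop := tendsto_atTop_mono hms tendsto_id
  -- The squares are b^(2 k^m) ≤ exp(2 b k^m), as b ≤ exp b. Hence one exponential beyond r, and B =
  -- 2b.
  refine not_eventually_le_iterate_exp (hf_top.comp htop) (K := k) hC
    (by exact_mod_cast (by omega : 1 ≤ k)) (.of_forall fun m => ?_) (r + 1) (2 * b)
    (by exact_mod_cast (by omega : 1 ≤ 2 * b)) ?_
  · have : s (m + 1) = s m ^ k := by rw [hs]; simp only [pow_succ, pow_mul]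
    simp only [Function.comp, this]
    exact h _ (hbM.trans (hbs m))
  · filter_upwards [htop.eventually hr] with m hm
    refine hm.trans ?_
    rw [Function.iterate_succ_apply]
    have hmono : Monotone (Real.exp^[r]) := Real.exp_monotone.iterate r
    refine hmono ?_
    have h1 : (b : ℝ) ≤ Real.exp b := by linarith [Real.add_one_le_exp (b : ℝ)]
    calc ((s m * s m : ℕ) : ℝ) = (b : ℝ) ^ (2 * k ^ m) := by
          rw [hs]; push_cast; rw [two_mul, pow_add]
      _ ≤ Real.exp b ^ (2 * k ^ m) := by gcongr
      _ = Real.exp (2 * b * k ^ m) := by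
          rw [← Real.exp_nat_mul]
          congr 1
          push_cast
          ring

theorem mainTheorem4
    (E : (n : ℕ) → QState n → ℝ) (hE : IsExtendableStrongMonotone E)
    (D : (n : ℕ) → QState n → QState n → ℝ) (hD : IsConvexContractiveDistance D)
    (ε δ : ℝ) (hε : 0 ≤ ε) (hδ : 0 ≤ δ) (hδ1 : δ < 1)
    (f : ℕ → ℝ) (hf_mono : Monotone f) (hf_top : Tendsto f atTop atTop)
    (hf_growth : ∃ r : ℕ, ∀ᶠ n : ℕ in atTop, f n ≤ Real.exp^[r] (n : ℝ))
    (hf_cluster : ∀ d : ℕ, 1 ≤ d → f (d * d) ≤ epsMeasure E D ε (clusterState d).toState)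
    {ι : Type*} (N : ι → ℕ) (σ : (i : ι) → QState (N i))
    (hscale : (fun i => E (N i) (σ i)) =O[comap N atTop] (fun i => Real.log (f (N i)))) :
    ¬ IsEfficientUniversal D ε δ N σ := by
  intro hU
  obtain ⟨φ, hφ, hφd⟩ := exists_hasPolyCircuits_clusterState
  obtain ⟨q, hq⟩ := hU φ hφ
  obtain ⟨k, hk⟩ := q.exists_eval_le_pow
  obtain ⟨c, hc⟩ := hscale.bound
  obtain ⟨M₁, hM₁⟩ := eventually_atTop.mp (eventually_comap.mp hc)
  obtain ⟨M₂, hM₂⟩ := eventually_atTop.mp (hf_top.eventually_ge_atTop 1)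
  -- The maximum with 1 and the exponent k + 2 meet the requirements 1 ≤ C and 2 ≤ k of the growth
  -- lemma; the threshold also ensures d ≥ 2.
  refine not_le_log_of_growth hf_top hf_growth (C := max 1 (|c| / (1 - δ))) (le_max_left ..)
    (k := k + 2) (by omega) (M := M₁ + M₂ + 2) fun d hd => ?_
  have hdd : d ≤ d * d := Nat.le_mul_self d
  obtain ⟨i, hn, hN, w, P, -, -, hP⟩ := hq (d * d)
  rw [hφd] at hP
  have h1 : 1 ≤ f (d * d) := hM₂ _ (by omega)
  have h2 : (1 - δ) * f (d * d) ≤ E (N i) (σ i) :=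
    hP.mul_epsMeasure_le hE hD (by linarith) (hf_cluster d (by omega))
  -- The asymptotic bound applies because padding forces N i ≥ d².
  have h3 := hM₁ (N i) (by omega) i rfl
  have h4 : 1 ≤ f (N i) := hM₂ _ (by omega)
  -- The size is rounded up to a square, so that the inequality can be iterated.
  have h5 : N i ≤ d ^ (k + 2) * d ^ (k + 2) :=
    calc N i ≤ (d * d) ^ k := hN.trans (hk _ (by omega))
      _ ≤ (d * d) ^ (k + 2) := Nat.pow_le_pow_right (by omega) (by omega)
      _ = _ := mul_pow ..
  have h6 : 0 ≤ Real.log (f (N i)) := Real.log_nonneg h4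
  have h7 : Real.log (f (N i)) ≤ Real.log (f (d ^ (k + 2) * d ^ (k + 2))) :=
    Real.log_le_log (by linarith) (hf_mono h5)
  rw [Real.norm_of_nonneg h6] at h3
  have hδ' : 0 < 1 - δ := by linarith
  calc f (d * d) ≤ |c| * Real.log (f (N i)) / (1 - δ) := by
        rw [le_div_iff₀' hδ']
        exact h2.trans ((Real.le_norm_self _).trans (h3.trans
          (mul_le_mul_of_nonneg_right (le_abs_self c) h6)))
    _ = |c| / (1 - δ) * Real.log (f (N i)) := by ring
    _ ≤ max 1 (|c| / (1 - δ)) * Real.log (f (d ^ (k + 2) * d ^ (k + 2))) :=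
        mul_le_mul (le_max_right ..) h7 h6 (zero_le_one.trans (le_max_left ..))
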